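/- For $d \in \mathbb{N}$, $f \in L^2(\mathbb{R}^d)$ and a window function $g$ on $\mathbb{R}^d$, let $$V_g f(x,\omega) = \int_{\mathbb{R}^d} f(t)\,\overline{g(t-x)}\,e^{-2\pi i \omega\cdot t}\,dt, \qquad (x,\omega) \in \mathbb{R}^{2d},$$ be the short-time Fourier transform of $f$ with window $g$. For $a,b \in (0,\infty)^d$, let $\mathcal{O}_a^b(\mathbb{C}^d)$ be the set of all entire functions $F:\mathbb{C}^d\to\mathbb{C}$ for which there is a constant $c>0$ such that $$|F(x+iy)| \le c \prod_{j=1}^d e^{-a_j x_j^2} e^{b_j y_j^2} \qquad \text{for all } x,y \in \mathbb{R}^d.$$ Let $\sqrt{\mathbb{Z}} = \{\pm\sqrt{n} : n \in \mathbb{N}_0\}$. **Theorem.** Let $a,b \in (0,\infty)^d$ and let $0 \neq \varphi \in \mathcal{O}_a^b(\mathbb{C}^d)$; the restriction of $\varphi$ to $\mathbb{R}^d$ serves as the window and is again denoted by $\varphi$. Let $\tau,\nu \in (0,\infty)^d$ satisfy $$\tau_j < \sqrt{\frac{1}{2 b_j e}}, \qquad \nu_j < \sqrt{\frac{a_j}{2\pi^2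 e}}, \qquad j = 1,\dots,d,$$ and let $\Lambda = A(\sqrt{\mathbb{Z}})^{2d} = \{Az : z \in (\sqrt{\mathbb{Z}})^{2d}\} \subseteq \mathbb{R}^{2d}$ with $A = \mathrm{diag}(\tau_1,\dots,\tau_d,\nu_1,\dots,\nu_d)$. Then for all $f,h \in L^2(\mathbb{R}^d)$ the following two statements are equivalent: 1. $|V_\varphi f(\lambda)| = |V_\varphi h(\lambda)|$ for every $\lambda \in \Lambda$; 2. there is $\theta \in \mathbb{C}$ with $|\theta| = 1$ such that $f = \theta h$. -/

import Mathlib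

open MeasureTheory

noncomputable section

namespace SqrtSampling

/-- The short-time Fourier transform of `f` with window `g`,
`V_g f (x, ω) = ∫ f(t) * conj (g (t - x)) * exp (-2 π i ω · t) dt` over `ℝ^d` with Lebesgue measure. -/
def stft {d : ℕ} (g f : EuclideanSpace ℝ (Fin d) → ℂ) (x ω : EuclideanSpace ℝ (Fin d)) : ℂ :=
  ∫ t : EuclideanSpace ℝ (Fin d),
    f t * (starRingEnd ℂ) (g (t - x)) *
      Complex.exp (-2 * (Real.pi : ℂ) * Complex.I * ((∑ j, ω j * t j : ℝ) : ℂ))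

/-- The short-time Fourier transform at a point `(x, ω)` of `ℝ^{2d}`, whose coordinates are indexed
by `Fin d ⊕ Fin d`: first the time coordinates `x`, then the frequency coordinates `ω`. -/
def stftAt {d : ℕ} (g f : EuclideanSpace ℝ (Fin d) → ℂ) (p : Fin d ⊕ Fin d → ℝ) : ℂ :=
  stft g f (WithLp.toLp 2 fun j => p (Sum.inl j)) (WithLp.toLp 2 fun j => p (Sum.inr j))

/-- The restriction to `ℝ^d` of a function on `ℂ^d`. -/
def realRestrict {d : ℕ} (F : (Fin d → ℂ) → ℂ) : EuclideanSpace ℝ (Fin d) → ℂ :=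
  fun t => F fun j => (t j : ℂ)

/-- The class `O_a^b(ℂ^d)`: entire functions `F` on `ℂ^d` for which there is `c > 0` with
`|F(x + i y)| ≤ c * ∏ j, exp (-a_j x_j^2) * exp (b_j y_j^2)` for all `x`, `y`. -/
def entireClass {d : ℕ} (a b : Fin d → ℝ) : Set ((Fin d → ℂ) → ℂ) :=
  {F | Differentiable ℂ F ∧ ∃ c : ℝ, 0 < c ∧ ∀ z : Fin d → ℂ,
    ‖F z‖ ≤ c * ∏ j, Real.exp (-a j * (z j).re ^ 2) * Real.exp (b j * (z j).im ^ 2)}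

/-- The set `√ℤ = {± √n : n ∈ ℕ₀}` of real numbers. -/
def sqrtInt : Set ℝ :=
  {s | ∃ n : ℕ, s = Real.sqrt n ∨ s = -Real.sqrt n}

/-- The set `A (√ℤ)^n = {A z : z ∈ √ℤ × ... × √ℤ}`; it is a square-root lattice with generating
matrix `A` when `A` is invertible. -/
def sqrtLattice {ι : Type*} [Fintype ι] (A : Matrix ι ι ℝ) : Set (ι → ℝ) :=
  {p | ∃ z : ι → ℝ, (∀ i, z i ∈ sqrtInt) ∧ p = A.mulVec z}

/-- Two square-integrable functions agree up to a global phase. -/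
def PhaseEquiv {d : ℕ} (f h : Lp ℂ 2 (volume : Measure (EuclideanSpace ℝ (Fin d)))) : Prop :=
  ∃ τ : ℂ, ‖τ‖ = 1 ∧ f = τ • h

end SqrtSampling

end

/-! ### Entire functions of one variable with zeros at scaled square roots. -/

namespace SqrtSampling

open Filter Topology

/-! Sampling step. The squared modulus `|V_φ f|^2` extends to `ℂ^{2d}` as `p ↦ V(p) * conj (V(conj
p))`, entire in each variable. The Gaussian bounds on the window, after completing the square, show
that this extension grows only in imaginary directions, like `exp (2 b_j y_j^2)` in time and `exp
((2 π^2 / a_j) η_j^2)` in frequency. A one-variable entire function bounded by `C * exp (B * y^2)`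
and vanishing on `σ√ℤ` is zero when `B σ^2 e < 1` (`eq_zero_of_sqrt_zeros`): dividing out `2N` zeros
and using the maximum principle on a circle of radius comparable to `√N` beats the growth. The
conditions on `τ` and `ν` are exactly this inequality in each coordinate, so equality of
spectrograms on the lattice spreads to all of `ℝ^{2d}`, one variable at a time
(`norm_stftAt_eq_of_sqrtLattice`).

Uniqueness step. For fixed time `x`, equal moduli of Fourier transforms mean equal autocorrelations
of `f * conj (φ(· - x))` and its analogue for `h`. At lag `u` this says that `D_u(t) = f(t) conj f(t
- u) - h(t) conj h(t - u)` has zero correlation with `ψ_u(s) = conj φ(s) φ(s - u)`. The Fourier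
transform of `ψ_u` extends to a nonzero separately entire function, so it is nonzero on a dense set
and `D_u = 0`. Hence `f(t) conj f(s) = h(t) conj h(s)` almost everywhere, which leaves only a global
phase (`exists_phase_of_norm_fourier_eq`). -/

/-- An entire function with zeros at `p ≠ 0` and `-p` is divisible by `z ^ 2 - p ^ 2`. -/
theorem exists_eq_sq_sub_sq_mul {g : ℂ → ℂ} (hg : Differentiable ℂ g) {p : ℂ} (hp : p ≠ 0)
    (h1 : g p = 0) (h2 : g (-p) = 0) :
    ∃ Q : ℂ → ℂ, Differentiable ℂ Q ∧ ∀ z, g z = (z ^ 2 - p ^ 2) * Q z := by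
  have hdiv : ∀ {g : ℂ → ℂ} (_ : Differentiable ℂ g) (p : ℂ) (_ : g p = 0),
      ∃ Q : ℂ → ℂ, Differentiable ℂ Q ∧ ∀ z, g z = (z - p) * Q z := by
    intro g hg p h
    refine ⟨dslope g p, ?_, fun z => ?_⟩
    · have := (Complex.differentiableOn_dslope (s := Set.univ) (c := p) (f := g) univ_mem).2
        hg.differentiableOn
      exact differentiableOn_univ.1 this
    · have := sub_smul_dslope g p z
      rw [h, sub_zero, smul_eq_mul] at this
      exact this.symm
  obtain ⟨Q, hQ, hgQ⟩ := hdiv hg p h1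
  have hQp : Q (-p) = 0 := by
    have := hgQ (-p)
    rw [h2] at this
    rcases mul_eq_zero.1 this.symm with h | h
    · exfalso
      apply hp
      linear_combination (-1 / 2 : ℂ) * h
    · exact h
  obtain ⟨Q', hQ', hQQ'⟩ := hdiv hQ (-p) hQp
  exact ⟨Q', hQ', fun z => by rw [hgQ, hQQ']; ring⟩

/-- Division of an entire function by finitely many factors `z ^ 2 - p n ^ 2`. -/
theorem exists_eq_prod_sq_sub_sq_mul {g : ℂ → ℂ} (hg : Differentiable ℂ g) (p : ℕ → ℂ)
    (hp : ∀ n, p n ≠ 0) (hinj : ∀ m n, p m ^ 2 = p n ^ 2 → m = n)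
    (h1 : ∀ n, g (p n) = 0) (h2 : ∀ n, g (-p n) = 0) (N : ℕ) :
    ∃ Q : ℂ → ℂ, Differentiable ℂ Q ∧
      ∀ z, g z = (∏ n ∈ Finset.range N, (z ^ 2 - p n ^ 2)) * Q z := by
  induction N with
  | zero => exact ⟨g, hg, fun z => by simp⟩
  | succ N ih =>
    obtain ⟨Q, hQ, hgQ⟩ := ih
    have hne : ∏ n ∈ Finset.range N, (p N ^ 2 - p n ^ 2) ≠ 0 := by
      refine Finset.prod_ne_zero_iff.2 fun n hn h => ?_
      have := hinj _ _ (sub_eq_zero.1 h)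
      simp at hn
      omega
    have hz : ∀ z, z ^ 2 = p N ^ 2 → g z = 0 → Q z = 0 := by
      intro z hz h0
      have := hgQ z
      rw [h0, hz] at this
      exact (mul_eq_zero.1 this.symm).resolve_left hne
    obtain ⟨Q', hQ', hQQ'⟩ := exists_eq_sq_sub_sq_mul hQ (hp N) (hz _ rfl (h1 N))
      (hz _ (neg_sq _) (h2 N))
    exact ⟨Q', hQ', fun z => by rw [hgQ, hQQ', Finset.prod_range_succ]; ring⟩

/-- Consecutive terms have ratio `x * (N / (N + 1)) ^ N`, which Bernoulli's inequality bounds by `x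
/ 2`. The limiting ratio is `x / e`, but the cruder `2` is enough here. -/
theorem tendsto_factorial_mul_pow_div_pow {x : ℝ} (hx0 : 0 < x) (hx : x < 2) :
    Tendsto (fun N : ℕ => (N.factorial : ℝ) * x ^ N / (N : ℝ) ^ N) atTop (𝓝 0) := by
  have hs : Summable (fun N : ℕ => (N.factorial : ℝ) * x ^ N / (N : ℝ) ^ N) := by
    refine summable_of_ratio_norm_eventually_le (r := x / 2) (by linarith) ?_
    filter_upwards [eventually_ge_atTop 1] with N hN
    have hN' : (0 : ℝ) < N := by exact_mod_cast hN
    have hb : 2 * (N : ℝ) ^ N ≤ ((N : ℝ) + 1) ^ N := by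
      have h := one_add_mul_le_pow (a := 1 / (N : ℝ)) (by have : 0 < 1 / (N : ℝ) := by positivity
                                                          linarith) N
      have h' : (1 : ℝ) + N * (1 / N) = 2 := by field_simp; norm_num
      rw [h'] at h
      calc 2 * (N : ℝ) ^ N ≤ (1 + 1 / (N : ℝ)) ^ N * (N : ℝ) ^ N := by gcongr
        _ = ((N : ℝ) + 1) ^ N := by rw [← mul_pow]; congr 1; field_simp
    rw [Real.norm_of_nonneg (by positivity), Real.norm_of_nonneg (by positivity),
      Nat.factorial_succ]
    push_cast
    rw [div_le_iff₀ (by positivity)]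
    calc ((N : ℝ) + 1) * N.factorial * x ^ (N + 1)
        = x / 2 * (N.factorial * x ^ N / N ^ N) * ((2 * (N : ℝ) ^ N) * (N + 1)) := by
          field_simp
          ring
      _ ≤ x / 2 * (N.factorial * x ^ N / N ^ N) * (((N : ℝ) + 1) ^ N * (N + 1)) := by gcongr
      _ = x / 2 * (N.factorial * x ^ N / N ^ N) * ((N : ℝ) + 1) ^ (N + 1) := by rw [pow_succ]
  exact hs.tendsto_atTop_zero

/-- An entire function whose growth is bounded by `exp (B * (im z) ^ 2)` away from the origin
and which has zeros at all `± σ √n`, `n ≥ 1`, vanishes at the origin. -/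
theorem apply_zero_eq_zero_of_sqrt_zeros {g : ℂ → ℂ} (hg : Differentiable ℂ g) {B C σ : ℝ}
    (hB : 0 ≤ B) (hσ : 0 < σ) (hBσ : B * σ ^ 2 * Real.exp 1 < 1)
    (hbd : ∀ z, 1 ≤ ‖z‖ → ‖g z‖ ≤ C * Real.exp (B * z.im ^ 2))
    (h1 : ∀ n : ℕ, g ((σ * Real.sqrt (n + 1) : ℝ) : ℂ) = 0)
    (h2 : ∀ n : ℕ, g (-((σ * Real.sqrt (n + 1) : ℝ) : ℂ)) = 0) : g 0 = 0 := by
  have hC : 0 ≤ C := by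
    have := (norm_nonneg _).trans (hbd 1 (by simp))
    exact nonneg_of_mul_nonneg_left this (Real.exp_pos _)
  have hsq : ∀ n : ℕ, ((σ * Real.sqrt (n + 1) : ℝ) : ℂ) ^ 2 = ((σ ^ 2 * (n + 1) : ℝ) : ℂ) := by
    intro n
    rw [← Complex.ofReal_pow, mul_pow, Real.sq_sqrt (by positivity)]
  have key : ∀ N : ℕ, 1 ≤ N → 1 ≤ 3 * σ ^ 2 * N →
      ‖g 0‖ ≤ C * (N.factorial * (Real.exp (3 * (B * σ ^ 2)) / 2) ^ N / (N : ℝ) ^ N) := by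
    intro N hN hN2
    have hN' : (0 : ℝ) < N := by exact_mod_cast hN
    obtain ⟨Q, hQ, hgQ⟩ := exists_eq_prod_sq_sub_sq_mul hg
      (fun n : ℕ => ((σ * Real.sqrt (n + 1) : ℝ) : ℂ))
      (fun n => by
        have : 0 < σ * Real.sqrt (n + 1) := by positivity
        exact_mod_cast this.ne')
      (fun m n h => by
        simp only [hsq] at h
        have h' : σ ^ 2 * ((m : ℝ) + 1) = σ ^ 2 * (n + 1) := by exact_mod_cast h
        have h'' := mul_left_cancel₀ (by positivity) h'
        have : (m : ℝ) = n := by linarith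
        exact_mod_cast this) h1 h2 N
    simp only [hsq] at hgQ
    -- On `|z|^2 = 3 σ^2 N` each of the `N` factors `z^2 - σ^2 n`, `n ≤ N`, has modulus at least `2
    -- σ^2 N`; this bounds the quotient `Q` on the circle.
    set R : ℝ := Real.sqrt (3 * σ ^ 2 * N) with hR
    have hRsq : R ^ 2 = 3 * σ ^ 2 * N := Real.sq_sqrt (by positivity)
    have hR1 : 1 ≤ R := by rw [hR]; exact Real.one_le_sqrt.2 hN2
    have hR0 : 0 < R := by linarith
    have hQbd : ∀ z ∈ Metric.sphere (0 : ℂ) R,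
        ‖Q z‖ ≤ C * Real.exp (B * (3 * σ ^ 2 * N)) / (2 * σ ^ 2 * N) ^ N := by
      intro z hz
      have hzn : ‖z‖ = R := by simpa using hz
      rw [le_div_iff₀ (by positivity)]
      have hprod : (2 * σ ^ 2 * N) ^ N ≤
          ‖∏ n ∈ Finset.range N, (z ^ 2 - ((σ ^ 2 * (n + 1) : ℝ) : ℂ))‖ := by
        rw [norm_prod]
        calc (2 * σ ^ 2 * N) ^ N = ∏ _n ∈ Finset.range N, (2 * σ ^ 2 * N) := by simp
          _ ≤ _ := by
            refine Finset.prod_le_prod (fun _ _ => by positivity) fun n hn => ?_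
            have hn' : (n : ℝ) + 1 ≤ N := by exact_mod_cast Finset.mem_range.1 hn
            have := norm_sub_norm_le (z ^ 2) ((σ ^ 2 * (n + 1) : ℝ) : ℂ)
            rw [norm_pow, hzn, hRsq, Complex.norm_real,
              Real.norm_of_nonneg (by positivity)] at this
            nlinarith [sq_nonneg σ, mul_le_mul_of_nonneg_left hn' (sq_nonneg σ)]
      have him : z.im ^ 2 ≤ 3 * σ ^ 2 * N := by
        rw [← hRsq, ← hzn]
        exact sq_le_sq' (by have := Complex.abs_im_le_norm z; rw [abs_le] at this; linarith)
          ((le_abs_self _).trans (Complex.abs_im_le_norm z))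
      calc ‖Q z‖ * (2 * σ ^ 2 * N) ^ N ≤
            ‖Q z‖ * ‖∏ n ∈ Finset.range N, (z ^ 2 - ((σ ^ 2 * (n + 1) : ℝ) : ℂ))‖ := by gcongr
        _ = ‖g z‖ := by rw [hgQ z, norm_mul, mul_comm]
        _ ≤ C * Real.exp (B * z.im ^ 2) := hbd z (by rw [hzn]; exact hR1)
        _ ≤ _ := by gcongr
    have hQ0 : ‖Q 0‖ ≤ C * Real.exp (B * (3 * σ ^ 2 * N)) / (2 * σ ^ 2 * N) ^ N := by
      refine Complex.norm_le_of_forall_mem_frontier_norm_le (U := Metric.ball (0 : ℂ) R)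
        Metric.isBounded_ball hQ.diffContOnCl ?_ (subset_closure (by simpa using hR0))
      intro z hz
      rw [frontier_ball _ hR0.ne'] at hz
      exact hQbd z hz
    have hfac : ‖∏ n ∈ Finset.range N, ((0 : ℂ) ^ 2 - ((σ ^ 2 * (n + 1) : ℝ) : ℂ))‖
        = (σ ^ 2) ^ N * N.factorial := by
      rw [norm_prod, ← Finset.prod_range_add_one_eq_factorial]
      push_cast
      rw [← Finset.card_range N, ← Finset.prod_const, Finset.card_range N,
        ← Finset.prod_mul_distrib]
      refine Finset.prod_congr rfl fun n _ => ?_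
      have : ((0 : ℂ) ^ 2 - (σ ^ 2 * (n + 1) : ℂ)) = ((-(σ ^ 2 * (n + 1)) : ℝ) : ℂ) := by
        push_cast; ring
      rw [this, Complex.norm_real, norm_neg, Real.norm_of_nonneg (by positivity)]
    rw [hgQ 0, norm_mul, hfac]
    calc (σ ^ 2) ^ N * (N.factorial : ℝ) * ‖Q 0‖
        ≤ (σ ^ 2) ^ N * (N.factorial : ℝ) *
          (C * Real.exp (B * (3 * σ ^ 2 * N)) / (2 * σ ^ 2 * N) ^ N) := by gcongr
      _ = _ := by
        rw [show B * (3 * σ ^ 2 * N) = N * (3 * (B * σ ^ 2)) by ring, Real.exp_nat_mul,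
          mul_pow, mul_pow, div_pow]
        field_simp
  -- The density condition enters here: `B σ^2 < 1/e` gives `3 B σ^2 < 3/2.7 < log 4`.
  have hx : Real.exp (3 * (B * σ ^ 2)) / 2 < 2 := by
    have hq : B * σ ^ 2 * 2.7 < 1 := by
      have := Real.exp_one_gt_d9
      have h0 : 0 ≤ B * σ ^ 2 := by positivity
      nlinarith
    have hl : 3 * (B * σ ^ 2) < Real.log 4 := by
      have : Real.log 4 = 2 * Real.log 2 := by
        rw [show (4 : ℝ) = 2 ^ 2 by norm_num, Real.log_pow]; norm_num
      have h2 := Real.log_two_gt_d9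
      linarith
    have := Real.exp_lt_exp.2 hl
    rw [Real.exp_log (by norm_num)] at this
    linarith
  have hlim := (tendsto_factorial_mul_pow_div_pow (by positivity) hx).const_mul C
  rw [mul_zero] at hlim
  have hge : ∀ᶠ N : ℕ in atTop, 1 ≤ 3 * σ ^ 2 * N :=
    (tendsto_natCast_atTop_atTop.const_mul_atTop (by positivity)).eventually_ge_atTop 1
  have : ‖g 0‖ ≤ 0 := ge_of_tendsto hlim (by
    filter_upwards [eventually_ge_atTop 1, hge] with N h1 h2 using key N h1 h2)
  simpa using this

/-- An entire function bounded by `C * exp (B * (im z) ^ 2)` is determined by its values on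
`σ √ℤ` as soon as `B * σ ^ 2 * e < 1`. -/
theorem eq_zero_of_sqrt_zeros {g : ℂ → ℂ} (hg : Differentiable ℂ g) {B C σ : ℝ}
    (hB : 0 ≤ B) (hσ : 0 < σ) (hBσ : B * σ ^ 2 * Real.exp 1 < 1)
    (hbd : ∀ z, ‖g z‖ ≤ C * Real.exp (B * z.im ^ 2))
    (hz : ∀ s ∈ sqrtInt, g ((σ * s : ℝ) : ℂ) = 0) : g = 0 := by
  by_contra hne
  have han : AnalyticAt ℂ g 0 := hg.analyticAt 0
  obtain ⟨q, hq⟩ : ∃ q, HasFPowerSeriesAt g q 0 := han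
  have hq0 : q ≠ 0 := by
    intro h0
    apply hne
    have : g =ᶠ[𝓝 0] 0 := (h0 ▸ hq : HasFPowerSeriesAt g 0 0).eventually_eq_zero
    exact AnalyticOnNhd.eq_of_eventuallyEq (fun z _ => hg.analyticAt z)
      (fun z _ => analyticAt_const) this
  -- The `k`-fold `dslope` at `0` is `g / z^k` once the earlier quotients vanish at `0`. Each
  -- quotient inherits the nonzero zeros and the growth of `g`, so each vanishes at `0`.
  have hent : ∀ k : ℕ, Differentiable ℂ ((Function.swap dslope 0)^[k] g) := by
    intro k
    induction k with
    | zero => exact hg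
    | succ k ih =>
      rw [Function.iterate_succ_apply']
      exact differentiableOn_univ.1 ((Complex.differentiableOn_dslope (s := Set.univ)
        (c := (0 : ℂ)) univ_mem).2 ih.differentiableOn)
  have hval : ∀ k : ℕ, (∀ i < k, ((Function.swap dslope 0)^[i] g) 0 = 0) →
      ∀ z, g z = z ^ k * ((Function.swap dslope 0)^[k] g) z := by
    intro k
    induction k with
    | zero => intro _ z; simp
    | succ k ih =>
      intro h z
      rw [ih (fun i hi => h i (by omega)) z, Function.iterate_succ_apply', pow_succ, mul_assoc]
      congr 1
      have := sub_smul_dslope ((Function.swap dslope 0)^[k] g) 0 z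
      rw [h k (by omega), sub_zero, sub_zero, smul_eq_mul] at this
      exact this.symm
  have hall : ∀ k : ℕ, ((Function.swap dslope 0)^[k] g) 0 = 0 := by
    intro k
    induction k using Nat.strong_induction_on with
    | _ k ih =>
      have hv := hval k ih
      have hzero : ∀ s ∈ sqrtInt, s ≠ 0 →
          ((Function.swap dslope 0)^[k] g) ((σ * s : ℝ) : ℂ) = 0 := by
        intro s hs hs0
        have := hv ((σ * s : ℝ) : ℂ)
        rw [hz s hs] at this
        refine (mul_eq_zero.1 this.symm).resolve_left (pow_ne_zero _ ?_)
        exact_mod_cast mul_ne_zero hσ.ne' hs0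
      have hpos : ∀ n : ℕ, Real.sqrt (n + 1) ≠ 0 := fun n => by positivity
      refine apply_zero_eq_zero_of_sqrt_zeros (hent k) hB hσ hBσ (C := C) ?_ ?_ ?_
      -- This is why growth is assumed only for `1 ≤ ‖z‖`: dividing by `z ^ k` does not increase the
      -- modulus there.
      · intro z hz1
        refine le_trans ?_ (hbd z)
        rw [hv z, norm_mul, norm_pow]
        exact le_mul_of_one_le_left (norm_nonneg _) (one_le_pow₀ hz1)
      · intro n
        exact hzero _ ⟨n + 1, Or.inl (by push_cast; rfl)⟩ (hpos n)
      · intro n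
        have := hzero _ ⟨n + 1, Or.inr (by push_cast; rfl)⟩ (neg_ne_zero.2 (hpos n))
        simpa using this
  -- At the order of vanishing of a nonzero `g`, the quotient would be nonzero at `0`.
  exact hq.iterate_dslope_fslope_ne_zero hq0 (hall _)

/-! ### Several variables, by coordinate slices. -/

/-- If every coordinate slice of `F` is determined by its values on `S i`, then `F` is determined
by its values on the product of the sets `S i`. -/
theorem eq_zero_of_slices {ι : Type*} [Finite ι] [DecidableEq ι] (F : (ι → ℂ) → ℂ)
    (S : ι → Set ℂ)
    (hS : ∀ i z, (∀ w ∈ S i, F (Function.update z i w) = 0) → ∀ w, F (Function.update z i w) = 0)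
    (h0 : ∀ z, (∀ i, z i ∈ S i) → F z = 0) (z : ι → ℂ) : F z = 0 := by
  classical
  have := Fintype.ofFinite ι
  -- `T` is the set of coordinates already freed from the constraint `z i ∈ S i`.
  suffices H : ∀ T : Finset ι, ∀ z, (∀ i, i ∉ T → z i ∈ S i) → F z = 0 from
    H Finset.univ z (by simp)
  intro T
  induction T using Finset.induction_on with
  | empty => intro z hz; exact h0 z fun i => hz i (by simp)
  | insert j T hj ih =>
    intro z hz
    have := hS j z (fun w hw => ih _ fun i hi => by
      by_cases hij : i = j
      · subst hij; simpa using hw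
      · rw [Function.update_of_ne hij]
        exact hz i (by simp [hij, hi])) (z j)
    rwa [Function.update_eq_self] at this

/-- A separately entire function of class `exp (B i * (im z i) ^ 2)` vanishing on a
square-root lattice of sufficient density is zero. -/
theorem eq_zero_of_sqrt_lattice {ι : Type*} [Fintype ι] [DecidableEq ι] {F : (ι → ℂ) → ℂ}
    (hF : ∀ z i, Differentiable ℂ fun w => F (Function.update z i w)) {B σ : ι → ℝ} {C : ℝ}
    (hB : ∀ i, 0 ≤ B i) (hσ : ∀ i, 0 < σ i) (hBσ : ∀ i, B i * σ i ^ 2 * Real.exp 1 < 1)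
    (hbd : ∀ z, ‖F z‖ ≤ C * ∏ i, Real.exp (B i * (z i).im ^ 2))
    (h0 : ∀ s : ι → ℝ, (∀ i, s i ∈ sqrtInt) → F (fun i => ((σ i * s i : ℝ) : ℂ)) = 0)
    (z : ι → ℂ) : F z = 0 := by
  refine eq_zero_of_slices F (fun i => {w | ∃ s ∈ sqrtInt, w = ((σ i * s : ℝ) : ℂ)}) ?_ ?_ z
  · intro i z hz w
    have := eq_zero_of_sqrt_zeros (hF z i) (hB i) (hσ i) (hBσ i)
      (C := C * ∏ j ∈ Finset.univ.erase i, Real.exp (B j * (z j).im ^ 2)) (fun w => ?_)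
      (fun s hs => hz _ ⟨s, hs, rfl⟩)
    · exact congrFun this w
    · refine (hbd _).trans (le_of_eq ?_)
      rw [← Finset.mul_prod_erase Finset.univ _ (Finset.mem_univ i), Function.update_self,
        mul_assoc, mul_comm (Real.exp (B i * w.im ^ 2))]
      congr 2
      refine Finset.prod_congr rfl fun j hj => ?_
      rw [Function.update_of_ne (Finset.ne_of_mem_erase hj)]
  · intro z hz
    choose s hs hzs using hz
    rw [funext hzs]
    exact h0 s hs

/-- A separately entire function vanishing on a real box is zero. -/
theorem eq_zero_of_real_box {ι : Type*} [Finite ι] [DecidableEq ι] {F : (ι → ℂ) → ℂ}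
    (hF : ∀ z i, Differentiable ℂ fun w => F (Function.update z i w)) (c : ι → ℝ) {ε : ℝ}
    (hε : 0 < ε) (h0 : ∀ s : ι → ℝ, (∀ i, |s i - c i| < ε) → F (fun i => (s i : ℂ)) = 0)
    (z : ι → ℂ) : F z = 0 := by
  refine eq_zero_of_slices F (fun i => {w | ∃ s : ℝ, |s - c i| < ε ∧ w = (s : ℂ)}) ?_ ?_ z
  · intro i z hz w
    have hfreq : ∃ᶠ w in 𝓝[≠] ((c i : ℝ) : ℂ), F (Function.update z i w) = 0 := by
      have ht : Tendsto (fun s : ℝ => (s : ℂ)) (𝓝[≠] (c i)) (𝓝[≠] ((c i : ℝ) : ℂ)) := by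
        refine tendsto_nhdsWithin_of_tendsto_nhds_of_eventually_within _
          (Complex.continuous_ofReal.continuousAt.mono_left nhdsWithin_le_nhds) ?_
        filter_upwards [self_mem_nhdsWithin] with s hs
        simpa using hs
      refine ht.frequently (Eventually.frequently ?_)
      have : ∀ᶠ s in 𝓝 (c i), |s - c i| < ε := by
        filter_upwards [Metric.ball_mem_nhds (c i) hε] with s hs
        simpa [Real.dist_eq] using hs
      filter_upwards [nhdsWithin_le_nhds this] with s hs
      exact hz _ ⟨s, hs, rfl⟩
    have := AnalyticOnNhd.eq_of_frequently_eq (f := fun w => F (Function.update z i w))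
      (g := fun _ => 0) (fun w _ => (hF z i).analyticAt w) (fun _ _ => analyticAt_const) hfreq
    exact congrFun this w
  · intro z hz
    choose s hs hzs using hz
    rw [funext hzs]
    exact h0 s hs

end SqrtSampling

/-! ### Fourier uniqueness, autocorrelation and correlation. -/

namespace SqrtSampling

open Filter Topology FourierTransform ContinuousLinearMap
open scoped Convolution ContDiff

section Fourier

variable {V : Type*} [NormedAddCommGroup V] [InnerProductSpace ℝ V] [FiniteDimensional ℝ V]
  [MeasurableSpace V] [BorelSpace V]

/-- The Fourier transform is injective on integrable functions. -/
theorem ae_eq_zero_of_fourier_eq_zero {f : V → ℂ} (hf : Integrable f) (h : ∀ ξ, 𝓕 f ξ = 0) :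
    ∀ᵐ t, f t = 0 := by
  refine ae_eq_zero_of_integral_contDiff_smul_eq_zero hf.locallyIntegrable fun g hg hgs => ?_
  have hgs' : HasCompactSupport (Complex.ofRealCLM ∘ g) := hgs.comp_left (map_zero _)
  have hg' : ContDiff ℝ ∞ (Complex.ofRealCLM ∘ g) := Complex.ofRealCLM.contDiff.comp hg
  set G : SchwartzMap V ℂ := hgs'.toSchwartzMap hg' with hG
  have hGval : ∀ x, G x = (g x : ℂ) := fun x => rfl
  -- Writing the test function as a Fourier transform lets the multiplication formula move the
  -- transform onto `f`.
  have hk : 𝓕 (𝓕⁻ G) = G := FourierTransform.fourier_fourierInv_eq G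
  have hkfun : ∀ x, 𝓕 ((𝓕⁻ G : SchwartzMap V ℂ) : V → ℂ) x = (g x : ℂ) := by
    intro x
    rw [← hGval x]
    conv_rhs => rw [← hk]
    rw [SchwartzMap.fourier_coe]
  have hflip := VectorFourier.integral_fourierIntegral_smul_eq_flip (μ := (volume : Measure V))
    (ν := (volume : Measure V)) (L := innerₗ V) (f := f)
    (g := ((𝓕⁻ G : SchwartzMap V ℂ) : V → ℂ)) Real.continuous_fourierChar continuous_inner hf
    (𝓕⁻ G : SchwartzMap V ℂ).integrable
  have hL : (innerₗ V).flip = innerₗ V := by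
    ext x y
    simp
  rw [hL] at hflip
  calc ∫ x, g x • f x = ∫ x, f x • 𝓕 ((𝓕⁻ G : SchwartzMap V ℂ) : V → ℂ) x := by
        refine integral_congr_ae (ae_of_all _ fun x => ?_)
        simp only [hkfun]
        rw [smul_eq_mul, mul_comm, Complex.real_smul]
    _ = ∫ ξ, 𝓕 f ξ • (𝓕⁻ G : SchwartzMap V ℂ) ξ := hflip.symm
    _ = 0 := by simp [h]

theorem fourier_conj_neg (f : V → ℂ) (ξ : V) :
    𝓕 (fun t => (starRingEnd ℂ) (f (-t))) ξ = (starRingEnd ℂ) (𝓕 f ξ) := by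
  rw [Real.fourier_eq', Real.fourier_eq', ← integral_conj, ← integral_neg_eq_self]
  refine integral_congr_ae (ae_of_all _ fun t => ?_)
  simp only [neg_neg, smul_eq_mul, map_mul, ← Complex.exp_conj, Complex.conj_ofReal,
    Complex.conj_I, inner_neg_left]
  congr 2
  push_cast
  ring

/-- Integrable functions whose Fourier transforms have equal modulus have equal
autocorrelations. -/
theorem autocorrelation_ae_eq {f h : V → ℂ} (hf : Integrable f) (hh : Integrable h)
    (hfh : ∀ ξ, ‖𝓕 f ξ‖ = ‖𝓕 h ξ‖) :
    ∀ᵐ u, ∫ t, f t * (starRingEnd ℂ) (f (t - u)) = ∫ t, h t * (starRingEnd ℂ) (h (t - u)) := by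
  have hconv : ∀ {f : V → ℂ}, Integrable f →
      Integrable (fun u => ∫ t, f t * (starRingEnd ℂ) (f (t - u))) ∧
      -- The autocorrelation is the convolution of `f` with `t ↦ conj (f (-t))`, so its transform is
      -- the squared modulus.
      ∀ ξ, 𝓕 (fun u => ∫ t, f t * (starRingEnd ℂ) (f (t - u))) ξ = (‖𝓕 f ξ‖ : ℂ) ^ 2 := by
    intro f hf
    have hf' : Integrable fun t => (starRingEnd ℂ) (f (-t)) :=
      (Complex.conjLIE.toContinuousLinearEquiv.toContinuousLinearMap.integrable_comp hf).comp_neg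
    have heq : (fun u => ∫ t, f t * (starRingEnd ℂ) (f (t - u))) =
        f ⋆[mul ℂ ℂ] (fun t => (starRingEnd ℂ) (f (-t))) := by
      ext u
      simp [convolution_def]
    rw [heq]
    refine ⟨hf.integrable_convolution _ hf', fun ξ => ?_⟩
    rw [Real.fourier_mul_convolution_eq hf hf', fourier_conj_neg, Complex.mul_conj']
  have hz := ae_eq_zero_of_fourier_eq_zero ((hconv hf).1.sub (hconv hh).1) (fun ξ => by
    have : 𝓕 ((fun u => ∫ t, f t * (starRingEnd ℂ) (f (t - u))) -
        fun u => ∫ t, h t * (starRingEnd ℂ) (h (t - u))) ξ =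
        𝓕 (fun u => ∫ t, f t * (starRingEnd ℂ) (f (t - u))) ξ -
        𝓕 (fun u => ∫ t, h t * (starRingEnd ℂ) (h (t - u))) ξ := by
      rw [Real.fourier_eq, Real.fourier_eq, Real.fourier_eq, ← integral_sub]
      · simp [smul_sub]
      · exact (Real.fourierIntegral_convergent_iff ξ).2 (hconv hf).1
      · exact (Real.fourierIntegral_convergent_iff ξ).2 (hconv hh).1
    rw [this, (hconv hf).2, (hconv hh).2, hfh, sub_self])
  filter_upwards [hz] with u hu using sub_eq_zero.1 hu

/-- If the correlation of an integrable function `D` with all translates of `ψ` vanishes and the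
Fourier transform of `ψ` is nonzero on a dense set, then `D = 0`. -/
theorem ae_eq_zero_of_correlation_eq_zero {D ψ : V → ℂ} (hD : Integrable D) (hψ : Integrable ψ)
    (hdense : Dense {ξ | 𝓕 ψ ξ ≠ 0}) (h : ∀ᵐ x, ∫ t, D t * ψ (t - x) = 0) :
    ∀ᵐ t, D t = 0 := by
  have hψ' : Integrable fun t => ψ (-t) := hψ.comp_neg
  have hneg : ∀ ξ, 𝓕 (fun t => ψ (-t)) ξ = 𝓕 ψ (-ξ) := by
    intro ξ
    rw [Real.fourier_eq, Real.fourier_eq, ← integral_neg_eq_self]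
    simp
  have hprod : ∀ ξ, 𝓕 D ξ * 𝓕 ψ (-ξ) = 0 := by
    intro ξ
    rw [← hneg, ← Real.fourier_mul_convolution_eq hD hψ', Real.fourier_eq]
    refine integral_eq_zero_of_ae ?_
    filter_upwards [h] with x hx
    simp only [convolution_def, mul_apply', Pi.zero_apply]
    simp only [neg_sub, hx, smul_zero]
  have hcont : Continuous (𝓕 D) :=
    VectorFourier.fourierIntegral_continuous Real.continuous_fourierChar continuous_inner hD
  refine ae_eq_zero_of_fourier_eq_zero hD fun ξ => ?_
  have hd : Dense {ξ | 𝓕 ψ (-ξ) ≠ 0} := hdense.preimage (Homeomorph.neg V).isOpenMap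
  have := Continuous.ext_on hd hcont continuous_const (g := fun _ => 0) fun ξ hξ =>
    (mul_eq_zero.1 (hprod ξ)).resolve_right hξ
  exact congrFun this ξ

end Fourier

/-! ### From correlations to a global phase. -/

/-- Two functions with `f t * conj (f s) = h t * conj (h s)` almost everywhere agree up to a
global phase. -/
theorem exists_phase_of_ae_ae_eq {α : Type*} [MeasurableSpace α] {μ : Measure α} {f h : α → ℂ}
    (H : ∀ᵐ s ∂μ, ∀ᵐ t ∂μ, f t * (starRingEnd ℂ) (f s) = h t * (starRingEnd ℂ) (h s)) :
    ∃ θ : ℂ, ‖θ‖ = 1 ∧ ∀ᵐ t ∂μ, f t = θ * h t := by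
  by_cases hf : ∀ᵐ s ∂μ, f s = 0
  · refine ⟨1, by simp, ?_⟩
    by_cases hh : ∀ᵐ s ∂μ, h s = 0
    · filter_upwards [hf, hh] with t h1 h2
      rw [h1, h2, mul_zero]
    · exfalso
      obtain ⟨s, hs, hs'⟩ := (not_eventually.1 hh).and_eventually H |>.exists
      apply hh
      filter_upwards [hf, hs'] with t h1 h2
      rw [h1, zero_mul] at h2
      exact (mul_eq_zero.1 h2.symm).resolve_right ((map_ne_zero _).2 hs)
  · obtain ⟨s, hs, hs'⟩ := (not_eventually.1 hf).and_eventually H |>.exists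
    have hs0 : (starRingEnd ℂ) (f s) ≠ 0 := (map_ne_zero _).2 hs
    set θ := (starRingEnd ℂ) (h s) / (starRingEnd ℂ) (f s) with hθ
    have hfθ : ∀ᵐ t ∂μ, f t = θ * h t := by
      filter_upwards [hs'] with t ht
      rw [hθ, div_mul_eq_mul_div, eq_div_iff hs0, ht, mul_comm]
    refine ⟨θ, ?_, hfθ⟩
    obtain ⟨s₁, hs1, hs2, hs3⟩ := ((not_eventually.1 hf).and_eventually (hfθ.and H)).exists
    obtain ⟨t, ht1, ht2, ht3⟩ := ((not_eventually.1 hf).and_eventually (hfθ.and hs3)).exists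
    have hn := congrArg norm ht3
    rw [ht2, hs2] at hn
    have hht : h t ≠ 0 := fun h0 => ht1 (by rw [ht2, h0, mul_zero])
    have hhs : h s₁ ≠ 0 := fun h0 => hs1 (by rw [hs2, h0, mul_zero])
    simp only [norm_mul, RCLike.norm_conj] at hn
    have : ‖θ‖ ^ 2 = 1 := by
      have hpos : 0 < ‖h t‖ * ‖h s₁‖ := mul_pos (norm_pos_iff.2 hht) (norm_pos_iff.2 hhs)
      have : ‖θ‖ ^ 2 * (‖h t‖ * ‖h s₁‖) = 1 * (‖h t‖ * ‖h s₁‖) := by linarith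
      exact mul_right_cancel₀ hpos.ne' this
    nlinarith [norm_nonneg θ]

/-- Uniqueness of phase retrieval from the full spectrogram, for windows whose ambiguity function
has nonvanishing slices on dense sets. -/
theorem exists_phase_of_norm_fourier_eq {V : Type*} [NormedAddCommGroup V]
    [InnerProductSpace ℝ V] [FiniteDimensional ℝ V] [MeasurableSpace V] [BorelSpace V]
    {f h w : V → ℂ} (hfm : StronglyMeasurable f) (hhm : StronglyMeasurable h)
    (hf : MemLp f 2) (hh : MemLp h 2) (hwc : Continuous w) (hw : MemLp w 2)
    {K : ℝ} (hwb : ∀ t, ‖w t‖ ≤ K)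
    (hdense : ∀ u, Dense {ξ | 𝓕 (fun s => (starRingEnd ℂ) (w s) * w (s - u)) ξ ≠ 0})
    (H : ∀ x ξ, ‖𝓕 (fun t => f t * (starRingEnd ℂ) (w (t - x))) ξ‖ =
      ‖𝓕 (fun t => h t * (starRingEnd ℂ) (w (t - x))) ξ‖) :
    ∃ θ : ℂ, ‖θ‖ = 1 ∧ ∀ᵐ t, f t = θ * h t := by
  have hsub : ∀ {g : V → ℂ} (_ : MemLp g 2) (x : V), MemLp (fun t => g (t - x)) 2 :=
    fun hg x => hg.comp_measurePreserving (measurePreserving_sub_right volume x)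
  have hconj : ∀ {g : V → ℂ} (_ : MemLp g 2), MemLp (fun t => (starRingEnd ℂ) (g t)) 2 :=
    fun hg => hg.star
  have hint : ∀ {g k : V → ℂ} (_ : MemLp g 2) (_ : MemLp k 2), Integrable fun t => g t * k t :=
    fun hg hk => hg.integrable_mul hk
  have hcorr : ∀ {g : V → ℂ} (_ : MemLp g 2) (u : V),
      Integrable fun t => g t * (starRingEnd ℂ) (g (t - u)) :=
    fun hg u => hint hg (hconj (hsub hg u))
  set D : V → V → ℂ := fun u t =>
    f t * (starRingEnd ℂ) (f (t - u)) - h t * (starRingEnd ℂ) (h (t - u)) with hDdef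
  set ψ : V → V → ℂ := fun u s => (starRingEnd ℂ) (w s) * w (s - u) with hψdef
  have hD : ∀ u, Integrable (D u) := fun u => (hcorr hf u).sub (hcorr hh u)
  have hψ : ∀ u, Integrable (ψ u) := fun u => hint (hconj hw) (hsub hw u)
  have hfm' := hfm.measurable
  have hhm' := hhm.measurable
  have hwm := hwc.measurable
  have hψc : ∀ u, Continuous (ψ u) := fun u => by fun_prop
  have hψb : ∀ u s, ‖ψ u s‖ ≤ K * K := fun u s => by
    rw [hψdef, norm_mul, RCLike.norm_conj]
    exact mul_le_mul (hwb _) (hwb _) (norm_nonneg _) ((norm_nonneg _).trans (hwb s))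
  have hmulψ : ∀ {g : V → ℂ} (_ : Integrable g) (u x : V),
      Integrable fun t => g t * ψ u (t - x) := fun hg u x =>
    hg.mul_bdd (c := K * K) ((hψc u).comp (continuous_id.sub continuous_const)).aestronglyMeasurable
      (ae_of_all _ fun t => hψb u _)
  have hI : ∀ x, ∀ᵐ u, ∫ t, D u t * ψ u (t - x) = 0 := by
    intro x
    have hwx := hconj (hsub hw x)
    filter_upwards [autocorrelation_ae_eq (hint hf hwx) (hint hh hwx) (H x)] with u hu
    -- At lag `u` the two window factors combine into one translate of `ψ u`, separating the signal
    -- from the window.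
    have e1 : ∀ g : V → ℂ, (fun t => g t * (starRingEnd ℂ) (w (t - x)) *
        (starRingEnd ℂ) (g (t - u) * (starRingEnd ℂ) (w (t - u - x)))) =
        fun t => g t * (starRingEnd ℂ) (g (t - u)) * ψ u (t - x) := by
      intro g
      ext t
      simp only [hψdef, map_mul, Complex.conj_conj, sub_right_comm t u x]
      ring
    rw [e1, e1] at hu
    simp only [hDdef, sub_mul]
    rw [integral_sub (hmulψ (hcorr hf u) u x) (hmulψ (hcorr hh u) u x), hu, sub_self]
  have hmeas : MeasurableSet {p : V × V | ∫ t, D p.2 t * ψ p.2 (t - p.1) = 0} := by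
    have : StronglyMeasurable fun p : V × V => ∫ t, D p.2 t * ψ p.2 (t - p.1) := by
      refine StronglyMeasurable.integral_prod_right
        (f := fun (p : V × V) (t : V) => D p.2 t * ψ p.2 (t - p.1))
        (Measurable.stronglyMeasurable ?_)
      simp only [hDdef, hψdef, Function.uncurry_def]
      have hc := Complex.continuous_conj.measurable
      fun_prop
    exact this.measurable (measurableSet_singleton 0)
  -- The exceptional lags depend on `x`; Fubini trades this for a fixed lag `u` with almost every
  -- `x`, as the correlation lemma requires.
  have hI' : ∀ᵐ u, ∀ᵐ x, ∫ t, D u t * ψ u (t - x) = 0 :=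
    (Measure.ae_ae_comm (p := fun x u => ∫ t, D u t * ψ u (t - x) = 0) hmeas).1
      (ae_of_all _ hI)
  have hDz : ∀ᵐ u, ∀ᵐ t, D u t = 0 := by
    filter_upwards [hI'] with u hu
    exact ae_eq_zero_of_correlation_eq_zero (hD u) (hψ u) (hdense u) hu
  have hmeas2 : MeasurableSet {p : V × V | D p.1 p.2 = 0} := by
    have : Measurable fun p : V × V => D p.1 p.2 := by
      simp only [hDdef]
      have hc := Complex.continuous_conj.measurable
      fun_prop
    exact this (measurableSet_singleton 0)
  have hDz' : ∀ᵐ t, ∀ᵐ u, D u t = 0 :=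
    (Measure.ae_ae_comm (p := fun u t => D u t = 0) hmeas2).1 hDz
  refine exists_phase_of_ae_ae_eq ?_
  filter_upwards [hDz'] with t ht
  -- Substituting `u = t - s` turns `f (t - u)` into `f s`.
  have := (Measure.measurePreserving_sub_left volume t).quasiMeasurePreserving.ae ht
  filter_upwards [this] with s hs
  have hs' := sub_eq_zero.1 hs
  rw [sub_sub_cancel] at hs'
  have := congrArg (starRingEnd ℂ) hs'
  simp only [map_mul, Complex.conj_conj] at this
  rw [mul_comm, this, mul_comm]

end SqrtSampling

/-! ### The entire extension of the short-time Fourier transform and its growth. -/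

namespace SqrtSampling

open Filter Topology

/-- A parametric integral of entire functions that is locally uniformly dominated is entire. -/
theorem differentiable_integral_of_locally_dominated {α : Type*} [MeasurableSpace α]
    {μ : Measure α} {F : ℂ → α → ℂ} (hm : ∀ w, AEStronglyMeasurable (F w) μ)
    (hd : ∀ t, Differentiable ℂ fun w => F w t)
    (hb : ∀ R : ℝ, ∃ G : α → ℝ, Integrable G μ ∧ ∀ w, ‖w‖ ≤ R → ∀ t, ‖F w t‖ ≤ G t) :
    Differentiable ℂ fun w => ∫ t, F w t ∂μ := by
  intro w₀
  -- One unit for the neighbourhood of `w₀`, one for the Cauchy circle that bounds the derivative by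
  -- the same `G`.
  obtain ⟨G, hG, hFG⟩ := hb (‖w₀‖ + 2)
  have hderiv : ∀ w ∈ Metric.ball w₀ 1, ∀ t, ‖deriv (fun w => F w t) w‖ ≤ G t := by
    intro w hw t
    have := Complex.norm_deriv_le_of_forall_mem_sphere_norm_le (c := w) (R := 1) (C := G t)
      zero_lt_one (hd t).diffContOnCl (fun z hz => hFG z ?_ t)
    · simpa using this
    · have h1 : ‖w - w₀‖ < 1 := by simpa [dist_eq_norm] using hw
      have h2 : ‖z - w‖ = 1 := by simpa [dist_eq_norm] using hz
      calc ‖z‖ = ‖w₀ + (w - w₀) + (z - w)‖ := by congr 1; ring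
        _ ≤ ‖w₀‖ + ‖w - w₀‖ + ‖z - w‖ := norm_add₃_le
        _ ≤ _ := by linarith
  -- The derivative is measurable in `t` as a pointwise limit of difference quotients.
  have hmd : AEStronglyMeasurable (fun t => deriv (fun w => F w t) w₀) μ := by
    have hu : Tendsto (fun n : ℕ => w₀ + 1 / ((n : ℂ) + 1)) atTop (𝓝[≠] w₀) := by
      refine tendsto_nhdsWithin_of_tendsto_nhds_of_eventually_within _ ?_ ?_
      · simpa using (tendsto_one_div_add_atTop_nhds_zero_nat (𝕜 := ℂ)).const_add w₀
      · refine Eventually.of_forall fun n => ?_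
        simpa using Nat.cast_add_one_ne_zero (R := ℂ) n
    refine aestronglyMeasurable_of_tendsto_ae (u := atTop)
      (f := fun (n : ℕ) t => slope (fun w => F w t) w₀ (w₀ + 1 / ((n : ℂ) + 1))) (fun n => ?_)
      (ae_of_all _ fun t => ((hd t w₀).hasDerivAt.tendsto_slope).comp hu)
    simp only [slope_def_field, div_eq_mul_inv]
    exact AEStronglyMeasurable.mul_const ((hm _).sub (hm _)) _
  refine (hasDerivAt_integral_of_dominated_loc_of_deriv_le (Metric.ball_mem_nhds w₀ zero_lt_one)
    (Eventually.of_forall hm) (hG.mono' (hm w₀) (ae_of_all _ fun t => hFG w₀ (by linarith) t)) hmd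
    (ae_of_all _ fun t w hw => hderiv w hw t) hG
    (ae_of_all _ fun t w _ => (hd t w).hasDerivAt)).2.differentiableAt

theorem differentiable_conj_comp_conj {g : ℂ → ℂ} (hg : Differentiable ℂ g) :
    Differentiable ℂ fun w => (starRingEnd ℂ) (g ((starRingEnd ℂ) w)) := by
  intro w
  have := DifferentiableAt.star_star (hg ((starRingEnd ℂ) w))
  rw [← starRingEnd_apply, Complex.conj_conj] at this
  exact this

variable {d : ℕ}

/-- The anisotropic Gaussian `∏ j, exp (-a j * t j ^ 2)`. -/
noncomputable def gaussWeight (a : Fin d → ℝ) (t : EuclideanSpace ℝ (Fin d)) : ℝ :=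
  ∏ j, Real.exp (-a j * t j ^ 2)

theorem integrable_gaussWeight_sq {a : Fin d → ℝ} (ha : ∀ j, 0 < a j) :
    Integrable fun t => gaussWeight a t ^ 2 := by
  have h1 : Integrable fun t : Fin d → ℝ => ∏ j, Real.exp (-(2 * a j) * t j ^ 2) :=
    Integrable.fintype_prod (f := fun j t => Real.exp (-(2 * a j) * t ^ 2))
      fun j => integrable_exp_neg_mul_sq (by linarith [ha j])
  have h2 := ((EuclideanSpace.volume_preserving_symm_measurableEquiv_toLp
    (Fin d)).integrable_comp_emb (MeasurableEquiv.measurableEmbedding _)).2 h1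
  refine h2.congr (ae_of_all _ fun t => ?_)
  simp only [gaussWeight, ← Finset.prod_pow, Function.comp]
  refine Finset.prod_congr rfl fun j _ => ?_
  rw [← Real.exp_nat_mul]
  congr 1
  simp
  ring

/-- The kernel of the entire extension of the short-time Fourier transform with window `φ`. -/
noncomputable def stftKernel (φ : (Fin d → ℂ) → ℂ) (p : Fin d ⊕ Fin d → ℂ)
    (t : EuclideanSpace ℝ (Fin d)) : ℂ :=
  (starRingEnd ℂ) (φ fun j => (starRingEnd ℂ) ((t j : ℂ) - p (Sum.inl j))) *
    Complex.exp (-2 * (Real.pi : ℂ) * Complex.I * ∑ j, p (Sum.inr j) * (t j : ℂ))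

/-- The entire extension to `ℂ^{2d}` of the short-time Fourier transform with window `φ`. -/
noncomputable def stftExt (φ : (Fin d → ℂ) → ℂ) (f : EuclideanSpace ℝ (Fin d) → ℂ)
    (p : Fin d ⊕ Fin d → ℂ) : ℂ :=
  ∫ t, f t * stftKernel φ p t

theorem stftExt_ofReal (φ : (Fin d → ℂ) → ℂ) (f : EuclideanSpace ℝ (Fin d) → ℂ)
    (p : Fin d ⊕ Fin d → ℝ) :
    stftExt φ f (fun i => (p i : ℂ)) = stftAt (realRestrict φ) f p := by
  unfold stftExt stftAt stft stftKernel realRestrict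
  refine integral_congr_ae (ae_of_all _ fun t => ?_)
  simp [mul_assoc]

theorem continuous_stftKernel {φ : (Fin d → ℂ) → ℂ} (hφ : Continuous φ)
    (p : Fin d ⊕ Fin d → ℂ) : Continuous (stftKernel φ p) := by
  unfold stftKernel
  have := Complex.continuous_conj
  fun_prop

/-- The inner and outer conjugations around `φ` cancel, so the kernel is holomorphic rather than
antiholomorphic in the time variable. -/
theorem differentiable_stftKernel_update {φ : (Fin d → ℂ) → ℂ} (hφ : Differentiable ℂ φ)
    (p : Fin d ⊕ Fin d → ℂ) (i : Fin d ⊕ Fin d) (t : EuclideanSpace ℝ (Fin d)) :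
    Differentiable ℂ fun w => stftKernel φ (Function.update p i w) t := by
  have hup : Differentiable ℂ fun w => Function.update p i w :=
    fun w => (hasFDerivAt_update p w).differentiableAt
  have hup' : ∀ k, Differentiable ℂ fun w => Function.update p i w k :=
    fun k => differentiable_pi.1 hup k
  unfold stftKernel
  refine Differentiable.mul ?_ ?_
  · have h1 : Differentiable ℂ fun w : ℂ => φ fun j => (t j : ℂ) -
        (starRingEnd ℂ) (Function.update p i ((starRingEnd ℂ) w) (Sum.inl j)) := by
      refine hφ.comp (differentiable_pi.2 fun j => ?_)
      exact (differentiable_const _).sub (differentiable_conj_comp_conj (hup' (Sum.inl j)))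
    have h2 := differentiable_conj_comp_conj h1
    simpa only [Complex.conj_conj, map_sub, Complex.conj_ofReal] using h2
  · have := hup'
    fun_prop

/-- Pointwise size of the kernel of the extended short-time Fourier transform. -/
theorem norm_stftKernel_le {a b : Fin d → ℝ} {φ : (Fin d → ℂ) → ℂ} {c : ℝ}
    (hφ : ∀ z : Fin d → ℂ,
      ‖φ z‖ ≤ c * ∏ j, Real.exp (-a j * (z j).re ^ 2) * Real.exp (b j * (z j).im ^ 2))
    (p : Fin d ⊕ Fin d → ℂ) (t : EuclideanSpace ℝ (Fin d)) :
    ‖stftKernel φ p t‖ ≤ c * ∏ j, Real.exp (-a j * (t j - (p (Sum.inl j)).re) ^ 2 +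
      b j * (p (Sum.inl j)).im ^ 2 + 2 * Real.pi * (p (Sum.inr j)).im * t j) := by
  have hexp : ‖Complex.exp (-2 * (Real.pi : ℂ) * Complex.I *
      ∑ j, p (Sum.inr j) * (t j : ℂ))‖ =
      ∏ j, Real.exp (2 * Real.pi * (p (Sum.inr j)).im * t j) := by
    rw [Complex.norm_exp, ← Real.exp_sum, Finset.mul_sum, Complex.re_sum]
    congr 1
    refine Finset.sum_congr rfl fun j _ => ?_
    simp
    ring
  rw [stftKernel, norm_mul, RCLike.norm_conj, hexp]
  refine (mul_le_mul_of_nonneg_right (hφ _)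
    (Finset.prod_nonneg fun _ _ => (Real.exp_pos _).le)).trans (le_of_eq ?_)
  rw [mul_assoc, ← Finset.prod_mul_distrib]
  congr 1
  refine Finset.prod_congr rfl fun j _ => ?_
  rw [← Real.exp_add, ← Real.exp_add]
  congr 1
  simp

theorem integrable_norm_sq {f : EuclideanSpace ℝ (Fin d) → ℂ} (hf : MemLp f 2) :
    Integrable fun t => ‖f t‖ ^ 2 := by
  simpa using hf.integrable_norm_pow (by norm_num)

theorem mul_le_sq_add_sq {x y : ℝ} : x * y ≤ x ^ 2 + y ^ 2 := by
  nlinarith [sq_nonneg (x - y), sq_nonneg x, sq_nonneg y]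

/-- Slices of the extended short-time Fourier transform are entire. -/
theorem differentiable_stftExt_update {a b : Fin d → ℝ} (ha : ∀ j, 0 < a j) (hb : ∀ j, 0 < b j)
    {φ : (Fin d → ℂ) → ℂ} (hφ : φ ∈ entireClass a b) {f : EuclideanSpace ℝ (Fin d) → ℂ}
    (hf : MemLp f 2) (p : Fin d ⊕ Fin d → ℂ) (i : Fin d ⊕ Fin d) :
    Differentiable ℂ fun w => stftExt φ f (Function.update p i w) := by
  obtain ⟨hφd, c, hc, hφc⟩ := hφ
  refine differentiable_integral_of_locally_dominated (fun w =>
    hf.aestronglyMeasurable.mul (continuous_stftKernel hφd.continuous _).aestronglyMeasurable)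
    (fun t => (differentiable_stftKernel_update hφd p i t).const_mul _) fun R => ?_
  set S : ℝ := max R ‖p‖
  have hS : ∀ w, ‖w‖ ≤ R → ∀ k, ‖Function.update p i w k‖ ≤ S := by
    intro w hw k
    by_cases hk : k = i
    · subst hk
      rw [Function.update_self]
      exact hw.trans (le_max_left _ _)
    · rw [Function.update_of_ne hk]
      exact (norm_le_pi_norm p k).trans (le_max_right _ _)
  set A : Fin d → ℝ := fun j => a j * S ^ 2 + b j * S ^ 2 + 4 * Real.pi ^ 2 * S ^ 2 / a j
  -- Expanding `(t - x)^2` costs half of the decay rate `a j`, and absorbing the linear frequency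
  -- term costs a further quarter. `A` collects what remains, uniformly for coordinates of modulus
  -- at most `S`.
  set a' : Fin d → ℝ := fun j => a j / 4
  refine ⟨fun t => (c * ∏ j, Real.exp (A j)) * (‖f t‖ ^ 2 + gaussWeight a' t ^ 2),
    ((integrable_norm_sq hf).add (integrable_gaussWeight_sq fun j => by
      have := ha j; simp only [a']; positivity)).const_mul _, fun w hw t => ?_⟩
  have hkey : ‖stftKernel φ (Function.update p i w) t‖ ≤
      (c * ∏ j, Real.exp (A j)) * gaussWeight a' t := by
    refine (norm_stftKernel_le hφc _ t).trans ?_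
    rw [gaussWeight, mul_assoc, ← Finset.prod_mul_distrib]
    refine mul_le_mul_of_nonneg_left (Finset.prod_le_prod (fun _ _ => (Real.exp_pos _).le)
      fun j _ => ?_) hc.le
    rw [← Real.exp_add, Real.exp_le_exp]
    generalize hP : Function.update p i w = P at *
    have hre := (Complex.abs_re_le_norm _).trans (hS w hw (Sum.inl j))
    have him := (Complex.abs_im_le_norm _).trans (hS w hw (Sum.inl j))
    have hin := (Complex.abs_im_le_norm _).trans (hS w hw (Sum.inr j))
    rw [hP] at hre him hin
    have hre2 := sq_le_sq' (abs_le.1 hre).1 (abs_le.1 hre).2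
    have him2 := sq_le_sq' (abs_le.1 him).1 (abs_le.1 him).2
    have hin2 := sq_le_sq' (abs_le.1 hin).1 (abs_le.1 hin).2
    have haj := ha j
    have hbj := hb j
    set x := (P (Sum.inl j)).re
    set y := (P (Sum.inl j)).im
    set η := (P (Sum.inr j)).im
    have e1 : -a j * (t j - x) ^ 2 ≤ -(a j / 2) * t j ^ 2 + a j * x ^ 2 := by
      nlinarith [sq_nonneg (t j - 2 * x)]
    have e2 : 2 * Real.pi * η * t j ≤ a j / 4 * t j ^ 2 + 4 * Real.pi ^ 2 * η ^ 2 / a j := by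
      have : a j / 4 * t j ^ 2 + 4 * Real.pi ^ 2 * η ^ 2 / a j - 2 * Real.pi * η * t j =
          (a j * t j / 2 - 2 * Real.pi * η) ^ 2 / a j := by
        field_simp
        ring
      have h0 : 0 ≤ (a j * t j / 2 - 2 * Real.pi * η) ^ 2 / a j := by positivity
      linarith
    have e3 : a j * x ^ 2 ≤ a j * S ^ 2 := by gcongr
    have e4 : b j * y ^ 2 ≤ b j * S ^ 2 := by gcongr
    have e5 : 4 * Real.pi ^ 2 * η ^ 2 / a j ≤ 4 * Real.pi ^ 2 * S ^ 2 / a j := by gcongr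
    simp only [A, a']
    linarith
  rw [norm_mul]
  have hC : 0 ≤ c * ∏ j, Real.exp (A j) :=
    mul_nonneg hc.le (Finset.prod_nonneg fun _ _ => (Real.exp_pos _).le)
  calc ‖f t‖ * ‖stftKernel φ (Function.update p i w) t‖
      ≤ ‖f t‖ * ((c * ∏ j, Real.exp (A j)) * gaussWeight a' t) := by gcongr
    _ = (c * ∏ j, Real.exp (A j)) * (‖f t‖ * gaussWeight a' t) := by ring
    _ ≤ _ := mul_le_mul_of_nonneg_left mul_le_sq_add_sq hC

/-- Growth of the extended short-time Fourier transform. -/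
theorem exists_norm_stftExt_le {a b : Fin d → ℝ} (ha : ∀ j, 0 < a j)
    {φ : (Fin d → ℂ) → ℂ} (hφ : φ ∈ entireClass a b) {f : EuclideanSpace ℝ (Fin d) → ℂ}
    (hf : MemLp f 2) :
    ∃ M : ℝ, 0 ≤ M ∧ ∀ p, ‖stftExt φ f p‖ ≤ M * ∏ j, Real.exp (b j * (p (Sum.inl j)).im ^ 2 +
      2 * Real.pi * (p (Sum.inr j)).im * (p (Sum.inl j)).re +
      Real.pi ^ 2 / a j * (p (Sum.inr j)).im ^ 2) := by
  obtain ⟨hφd, c, hc, hφc⟩ := hφ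
  refine ⟨c * ((∫ t, ‖f t‖ ^ 2) + ∫ t, gaussWeight a t ^ 2), by positivity, fun p => ?_⟩
  set E : ℝ := ∏ j, Real.exp (b j * (p (Sum.inl j)).im ^ 2 +
      2 * Real.pi * (p (Sum.inr j)).im * (p (Sum.inl j)).re +
      Real.pi ^ 2 / a j * (p (Sum.inr j)).im ^ 2) with hE
  have hE0 : 0 ≤ E := Finset.prod_nonneg fun _ _ => (Real.exp_pos _).le
  -- Centre of the Gaussian obtained by completing the square in `-a (t - x)^2 + 2 π η t`.
  -- Translation invariance then removes it, so `M` does not depend on `p`.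
  set m : EuclideanSpace ℝ (Fin d) :=
    WithLp.toLp 2 fun j => (p (Sum.inl j)).re + Real.pi * (p (Sum.inr j)).im / a j with hm
  have hkey : ∀ t, ‖stftKernel φ p t‖ ≤ c * E * gaussWeight a (t - m) := by
    intro t
    refine (norm_stftKernel_le hφc p t).trans (le_of_eq ?_)
    rw [hE, gaussWeight, mul_assoc, ← Finset.prod_mul_distrib]
    congr 1
    refine Finset.prod_congr rfl fun j _ => ?_
    rw [← Real.exp_add]
    congr 1
    have haj := (ha j).ne'
    simp only [hm, PiLp.sub_apply]
    field_simp
    ring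
  have hint2 : Integrable fun t => gaussWeight a (t - m) ^ 2 :=
    (integrable_gaussWeight_sq ha).comp_sub_right m
  have hbd : ∀ t, ‖f t * stftKernel φ p t‖ ≤
      c * E * (‖f t‖ ^ 2 + gaussWeight a (t - m) ^ 2) := by
    intro t
    rw [norm_mul]
    calc ‖f t‖ * ‖stftKernel φ p t‖ ≤ ‖f t‖ * (c * E * gaussWeight a (t - m)) := by
          gcongr; exact hkey t
      _ = c * E * (‖f t‖ * gaussWeight a (t - m)) := by ring
      _ ≤ _ := mul_le_mul_of_nonneg_left mul_le_sq_add_sq (by positivity)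
  have hG := ((integrable_norm_sq hf).add hint2).const_mul (c * E)
  calc ‖stftExt φ f p‖ ≤ ∫ t, c * E * (‖f t‖ ^ 2 + gaussWeight a (t - m) ^ 2) :=
        norm_integral_le_of_norm_le hG (ae_of_all _ hbd)
    _ = c * E * ((∫ t, ‖f t‖ ^ 2) + ∫ t, gaussWeight a t ^ 2) := by
        rw [integral_const_mul, integral_add (integrable_norm_sq hf) hint2,
          integral_sub_right_eq_self (fun t => gaussWeight a t ^ 2) m]
    _ = _ := by ring

end SqrtSampling

/-! ### Density for the ambiguity function, then the sampling step. -/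

namespace SqrtSampling

open Filter Topology FourierTransform

variable {d : ℕ}

theorem stft_eq_fourier (g f : EuclideanSpace ℝ (Fin d) → ℂ) (x ω : EuclideanSpace ℝ (Fin d)) :
    stft g f x ω = 𝓕 (fun t => f t * (starRingEnd ℂ) (g (t - x))) ω := by
  rw [stft, Real.fourier_eq']
  refine integral_congr_ae (ae_of_all _ fun t => ?_)
  simp only [smul_eq_mul]
  rw [mul_comm]
  congr 2
  rw [PiLp.inner_apply]
  simp
  ring

theorem norm_realRestrict_le {a b : Fin d → ℝ} {φ : (Fin d → ℂ) → ℂ} (hφ : φ ∈ entireClass a b) :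
    ∃ c : ℝ, 0 < c ∧ ∀ t, ‖realRestrict φ t‖ ≤ c * gaussWeight a t := by
  obtain ⟨-, c, hc, h⟩ := hφ
  exact ⟨c, hc, fun t => by simpa [realRestrict, gaussWeight] using h fun j => (t j : ℂ)⟩

theorem continuous_realRestrict {φ : (Fin d → ℂ) → ℂ} (hφ : Continuous φ) :
    Continuous (realRestrict φ) := by
  unfold realRestrict
  fun_prop

theorem exists_bound_realRestrict {a b : Fin d → ℝ} (ha : ∀ j, 0 < a j) {φ : (Fin d → ℂ) → ℂ}
    (hφ : φ ∈ entireClass a b) : ∃ K : ℝ, ∀ t, ‖realRestrict φ t‖ ≤ K := by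
  obtain ⟨c, hc, h⟩ := norm_realRestrict_le hφ
  refine ⟨c, fun t => (h t).trans (mul_le_of_le_one_right hc.le ?_)⟩
  refine Finset.prod_le_one (fun _ _ => (Real.exp_pos _).le) fun j _ => ?_
  rw [Real.exp_le_one_iff]
  nlinarith [mul_nonneg (ha j).le (sq_nonneg (t j))]

theorem memLp_realRestrict {a b : Fin d → ℝ} (ha : ∀ j, 0 < a j) {φ : (Fin d → ℂ) → ℂ}
    (hφ : φ ∈ entireClass a b) : MemLp (realRestrict φ) 2 := by
  obtain ⟨c, hc, h⟩ := norm_realRestrict_le hφ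
  have hm : AEStronglyMeasurable (realRestrict φ) volume :=
    (continuous_realRestrict hφ.1.continuous).aestronglyMeasurable
  refine (memLp_two_iff_integrable_sq_norm hm).2 ?_
  refine ((integrable_gaussWeight_sq ha).const_mul (c ^ 2)).mono' (hm.norm.pow 2)
    (ae_of_all _ fun t => ?_)
  rw [Real.norm_of_nonneg (by positivity), ← mul_pow]
  exact pow_le_pow_left₀ (norm_nonneg _) (h t) 2

theorem differentiable_update_slice {ι : Type*} [Fintype ι] [DecidableEq ι] {φ : (ι → ℂ) → ℂ}
    (hφ : Differentiable ℂ φ) (z : ι → ℂ) (i : ι) :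
    Differentiable ℂ fun w => φ (Function.update z i w) :=
  hφ.comp fun w => (hasFDerivAt_update z w).differentiableAt

/-- An entire function on `ℂ^d` vanishing on an open nonempty set of real points is zero. -/
theorem eq_zero_of_eventually_realRestrict_eq_zero {φ : (Fin d → ℂ) → ℂ}
    (hF : ∀ z i, Differentiable ℂ fun w => φ (Function.update z i w))
    (x : EuclideanSpace ℝ (Fin d)) (h : ∀ᶠ t in 𝓝 x, realRestrict φ t = 0) : φ = 0 := by
  have hc : Continuous fun s : Fin d → ℝ => (WithLp.toLp 2 s : EuclideanSpace ℝ (Fin d)) :=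
    PiLp.continuous_toLp 2 _
  have h' : ∀ᶠ s in 𝓝 (x.ofLp), realRestrict φ (WithLp.toLp 2 s) = 0 :=
    hc.continuousAt.eventually (by simpa using h)
  obtain ⟨ε, hε, hball⟩ := Metric.eventually_nhds_iff.1 h'
  funext z
  refine eq_zero_of_real_box hF x.ofLp hε (fun s hs => ?_) z
  exact hball ((dist_pi_lt_iff hε).2 fun i => by simpa [Real.dist_eq] using hs i)

/-- The slices of the ambiguity function of a nonzero window in `entireClass a b` are nonzero on
a dense set. -/
theorem dense_fourier_ne_zero {a b : Fin d → ℝ} (ha : ∀ j, 0 < a j) (hb : ∀ j, 0 < b j)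
    {φ : (Fin d → ℂ) → ℂ} (hφ : φ ∈ entireClass a b) (hφ0 : φ ≠ 0)
    (u : EuclideanSpace ℝ (Fin d)) :
    Dense {ξ | 𝓕 (fun s => (starRingEnd ℂ) (realRestrict φ s) * realRestrict φ (s - u)) ξ ≠ 0} := by
  set ψ : EuclideanSpace ℝ (Fin d) → ℂ :=
    fun s => (starRingEnd ℂ) (realRestrict φ s) * realRestrict φ (s - u) with hψ
  have hwc := continuous_realRestrict hφ.1.continuous
  have hmem : MemLp (fun t => realRestrict φ (t - u)) 2 :=
    (memLp_realRestrict ha hφ).comp_measurePreserving (measurePreserving_sub_right volume u)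
  have hψint : Integrable ψ := (memLp_realRestrict ha hφ).star.integrable_mul hmem
  -- `𝓕 ψ` is the transform of the translated window at time `0`, so it inherits a separately entire
  -- extension.
  set Ψ : (Fin d → ℂ) → ℂ :=
    fun ω => stftExt φ (fun t => realRestrict φ (t - u)) (Sum.elim 0 ω) with hΨ
  have hΨd : ∀ z i, Differentiable ℂ fun w => Ψ (Function.update z i w) := by
    intro z i
    have := differentiable_stftExt_update ha hb hφ hmem (Sum.elim 0 z) (Sum.inr i)
    simpa only [hΨ, ← Sum.elim_update_right] using this
  have hΨr : ∀ ξ, realRestrict Ψ ξ = 𝓕 ψ ξ := by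
    intro ξ
    have h1 : (Sum.elim (0 : Fin d → ℂ) fun j => (ξ j : ℂ)) =
        fun i => ((Sum.elim (0 : Fin d → ℝ) ξ.ofLp i : ℝ) : ℂ) := by
      ext i
      cases i <;> simp
    have h0 : (WithLp.toLp 2 fun _ : Fin d => (0 : ℝ)) = (0 : EuclideanSpace ℝ (Fin d)) := rfl
    simp only [realRestrict, hΨ]
    rw [h1]
    refine (stftExt_ofReal φ _ _).trans ?_
    simp only [stftAt, stft_eq_fourier, Sum.elim_inl, Sum.elim_inr, Pi.zero_apply, h0, sub_zero]
    have hcomm : ψ = fun s => realRestrict φ (s - u) * (starRingEnd ℂ) (realRestrict φ s) :=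
      funext fun s => mul_comm _ _
    rw [hcomm]
    rfl
  intro ξ₀
  by_contra hcl
  rw [mem_closure_iff_frequently, not_frequently] at hcl
  have hΨ0 : Ψ = 0 := eq_zero_of_eventually_realRestrict_eq_zero hΨd ξ₀ (by
    filter_upwards [hcl] with ξ hξ
    rw [hΨr]
    simpa using hξ)
  have hψ0 : ∀ᵐ s, ψ s = 0 := ae_eq_zero_of_fourier_eq_zero hψint fun ξ => by
    rw [← hΨr, hΨ0]
    rfl
  have hψc : Continuous ψ := by
    have := Complex.continuous_conj
    fun_prop
  have hψ0' : ψ = fun _ => 0 :=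
    (Continuous.ae_eq_iff_eq volume hψc continuous_const).1 hψ0
  obtain ⟨s₀, hs₀⟩ : ∃ s, realRestrict φ s ≠ 0 := by
    by_contra! hall
    exact hφ0 (eq_zero_of_eventually_realRestrict_eq_zero (differentiable_update_slice hφ.1) 0
      (Eventually.of_forall hall))
  refine hφ0 (eq_zero_of_eventually_realRestrict_eq_zero (differentiable_update_slice hφ.1)
    (s₀ - u) ?_)
  -- Since `ψ = 0`, the window vanishes near `s₀ - u` wherever its translate by `u` is nonzero, and
  -- the identity theorem then kills `φ`.
  have hne : ∀ᶠ t in 𝓝 (s₀ - u), realRestrict φ (t + u) ≠ 0 := by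
    refine ContinuousAt.eventually_ne (by fun_prop) ?_
    simpa using hs₀
  filter_upwards [hne] with t ht
  have := congrFun hψ0' (t + u)
  simp only [hψ, add_sub_cancel_right] at this
  exact (mul_eq_zero.1 this).resolve_left ((map_ne_zero _).2 ht)

/-- The entire extension to `ℂ^{2d}` of the spectrogram `|V_φ f| ^ 2`. -/
noncomputable def spectrogramExt (φ : (Fin d → ℂ) → ℂ) (f : EuclideanSpace ℝ (Fin d) → ℂ)
    (p : Fin d ⊕ Fin d → ℂ) : ℂ :=
  stftExt φ f p * (starRingEnd ℂ) (stftExt φ f fun i => (starRingEnd ℂ) (p i))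

theorem spectrogramExt_ofReal (φ : (Fin d → ℂ) → ℂ) (f : EuclideanSpace ℝ (Fin d) → ℂ)
    (p : Fin d ⊕ Fin d → ℝ) :
    spectrogramExt φ f (fun i => (p i : ℂ)) = (‖stftAt (realRestrict φ) f p‖ : ℂ) ^ 2 := by
  simp only [spectrogramExt, Complex.conj_ofReal, stftExt_ofReal, Complex.mul_conj']

theorem differentiable_spectrogramExt_update {a b : Fin d → ℝ} (ha : ∀ j, 0 < a j)
    (hb : ∀ j, 0 < b j) {φ : (Fin d → ℂ) → ℂ} (hφ : φ ∈ entireClass a b)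
    {f : EuclideanSpace ℝ (Fin d) → ℂ} (hf : MemLp f 2) (p : Fin d ⊕ Fin d → ℂ)
    (i : Fin d ⊕ Fin d) :
    Differentiable ℂ fun w => spectrogramExt φ f (Function.update p i w) := by
  have hup : ∀ w, (fun k => (starRingEnd ℂ) (Function.update p i w k)) =
      Function.update (fun k => (starRingEnd ℂ) (p k)) i ((starRingEnd ℂ) w) := by
    intro w
    ext k
    by_cases hk : k = i
    · subst hk
      simp
    · simp [Function.update_of_ne hk]
  simp only [spectrogramExt, hup]
  exact (differentiable_stftExt_update ha hb hφ hf p i).mul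
    (differentiable_conj_comp_conj (differentiable_stftExt_update ha hb hφ hf _ i))

/-- The cross term `2 π η x` in the growth of the transform changes sign from `p` to `conj p`, so it
cancels in the product. Only imaginary parts remain, with both rates doubled; the transform alone
would not fit the one-variable uniqueness lemma. -/
theorem exists_norm_spectrogramExt_le {a b : Fin d → ℝ} (ha : ∀ j, 0 < a j)
    {φ : (Fin d → ℂ) → ℂ} (hφ : φ ∈ entireClass a b) {f : EuclideanSpace ℝ (Fin d) → ℂ}
    (hf : MemLp f 2) :
    ∃ M : ℝ, ∀ p, ‖spectrogramExt φ f p‖ ≤ M * ∏ i, Real.exp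
      (Sum.elim (fun j => 2 * b j) (fun j => 2 * Real.pi ^ 2 / a j) i * (p i).im ^ 2) := by
  obtain ⟨M, hM, h⟩ := exists_norm_stftExt_le ha hφ hf
  refine ⟨M * M, fun p => ?_⟩
  rw [spectrogramExt, norm_mul, RCLike.norm_conj]
  refine (mul_le_mul (h _) (h _) (norm_nonneg _) (mul_nonneg hM
    (Finset.prod_nonneg fun _ _ => (Real.exp_pos _).le))).trans (le_of_eq ?_)
  rw [mul_mul_mul_comm, ← Finset.prod_mul_distrib, Fintype.prod_sum_type,
    ← Finset.prod_mul_distrib]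
  congr 1
  refine Finset.prod_congr rfl fun j _ => ?_
  rw [← Real.exp_add, ← Real.exp_add]
  congr 1
  simp only [Complex.conj_re, Complex.conj_im, Sum.elim_inl, Sum.elim_inr]
  ring

/-- Spectrograms agreeing on a sufficiently dense square-root lattice agree everywhere. -/
theorem norm_stftAt_eq_of_sqrtLattice {a b : Fin d → ℝ} (ha : ∀ j, 0 < a j) (hb : ∀ j, 0 < b j)
    {φ : (Fin d → ℂ) → ℂ} (hφ : φ ∈ entireClass a b) {τ ν : Fin d → ℝ} (hτ : ∀ j, 0 < τ j)
    (hν : ∀ j, 0 < ν j) (hτb : ∀ j, τ j < Real.sqrt (1 / (2 * b j * Real.exp 1)))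
    (hνa : ∀ j, ν j < Real.sqrt (a j / (2 * Real.pi ^ 2 * Real.exp 1)))
    {f h : EuclideanSpace ℝ (Fin d) → ℂ} (hf : MemLp f 2) (hh : MemLp h 2)
    (H : ∀ p ∈ sqrtLattice (Matrix.diagonal (Sum.elim τ ν)),
      ‖stftAt (realRestrict φ) f p‖ = ‖stftAt (realRestrict φ) h p‖) (p : Fin d ⊕ Fin d → ℝ) :
    ‖stftAt (realRestrict φ) f p‖ = ‖stftAt (realRestrict φ) h p‖ := by
  obtain ⟨M, hM⟩ := exists_norm_spectrogramExt_le ha hφ hf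
  obtain ⟨M', hM'⟩ := exists_norm_spectrogramExt_le ha hφ hh
  have he := Real.exp_pos 1
  have key := eq_zero_of_sqrt_lattice (F := fun p => spectrogramExt φ f p - spectrogramExt φ h p)
    (σ := Sum.elim τ ν) (B := Sum.elim (fun j => 2 * b j) (fun j => 2 * Real.pi ^ 2 / a j))
    (C := M + M')
    (fun z i => (differentiable_spectrogramExt_update ha hb hφ hf z i).sub
      (differentiable_spectrogramExt_update ha hb hφ hh z i)) ?_ ?_ ?_ ?_ ?_
      (fun i => (p i : ℂ))
  · have h2 := sub_eq_zero.1 key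
    rw [spectrogramExt_ofReal, spectrogramExt_ofReal] at h2
    have h3 : ‖stftAt (realRestrict φ) f p‖ ^ 2 = ‖stftAt (realRestrict φ) h p‖ ^ 2 := by
      exact_mod_cast h2
    exact (sq_eq_sq₀ (norm_nonneg _) (norm_nonneg _)).1 h3
  · rintro (j | j)
    · have := hb j
      simp only [Sum.elim_inl]
      positivity
    · have := ha j
      simp only [Sum.elim_inr]
      positivity
  · rintro (j | j)
    · exact hτ j
    · exact hν j
  -- Squaring the bounds on `τ j` and `ν j` gives exactly `B σ^2 e < 1` for the rates `2 b j` and `2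
  -- π^2 / a j`.
  · rintro (j | j)
    · have h1 := (Real.lt_sqrt (hτ j).le).1 (hτb j)
      have hbj := hb j
      rw [lt_div_iff₀ (by positivity)] at h1
      simp only [Sum.elim_inl]
      linarith
    · have h1 := (Real.lt_sqrt (hν j).le).1 (hνa j)
      have haj := ha j
      rw [lt_div_iff₀ (by positivity)] at h1
      simp only [Sum.elim_inr]
      rw [div_mul_eq_mul_div, div_mul_eq_mul_div, div_lt_one haj]
      linarith
  · intro z
    rw [add_mul]
    exact (norm_sub_le _ _).trans (add_le_add (hM z) (hM' z))
  · intro s hs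
    have hmem := H (fun i => Sum.elim τ ν i * s i)
      ⟨s, hs, by ext i; rw [Matrix.mulVec_diagonal]⟩
    have e1 := spectrogramExt_ofReal φ f (fun i => Sum.elim τ ν i * s i)
    have e2 := spectrogramExt_ofReal φ h (fun i => Sum.elim τ ν i * s i)
    simp only [e1, e2, hmem, sub_self]

theorem norm_stftAt_eq_of_ae_eq_mul {g f h : EuclideanSpace ℝ (Fin d) → ℂ} {θ : ℂ}
    (hθ : ‖θ‖ = 1) (hfh : ∀ᵐ t, f t = θ * h t) (p : Fin d ⊕ Fin d → ℝ) :
    ‖stftAt g f p‖ = ‖stftAt g h p‖ := by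
  have : stftAt g f p = θ * stftAt g h p := by
    rw [stftAt, stftAt, stft, stft, ← integral_const_mul]
    refine integral_congr_ae ?_
    filter_upwards [hfh] with t ht
    rw [ht]
    ring
  rw [this, norm_mul, hθ, one_mul]

end SqrtSampling

theorem theorem1 (d : ℕ) (a b : Fin d → ℝ) (ha : ∀ j, 0 < a j) (hb : ∀ j, 0 < b j)
    (φ : (Fin d → ℂ) → ℂ) (hφ : φ ∈ SqrtSampling.entireClass a b) (hφ0 : φ ≠ 0)
    (τ ν : Fin d → ℝ) (hτ : ∀ j, 0 < τ j) (hν : ∀ j, 0 < ν j)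
    (hτb : ∀ j, τ j < Real.sqrt (1 / (2 * b j * Real.exp 1)))
    (hνa : ∀ j, ν j < Real.sqrt (a j / (2 * Real.pi ^ 2 * Real.exp 1)))
    (f h : MeasureTheory.Lp ℂ 2
      (MeasureTheory.volume : MeasureTheory.Measure (EuclideanSpace ℝ (Fin d)))) :
    (∀ p ∈ SqrtSampling.sqrtLattice (Matrix.diagonal (Sum.elim τ ν)),
      ‖SqrtSampling.stftAt (SqrtSampling.realRestrict φ) f p‖ =
        ‖SqrtSampling.stftAt (SqrtSampling.realRestrict φ) h p‖) ↔
    SqrtSampling.PhaseEquiv f h := by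
  constructor
  · intro H
    have hall := SqrtSampling.norm_stftAt_eq_of_sqrtLattice ha hb hφ hτ hν hτb hνa (Lp.memLp f)
      (Lp.memLp h) H
    obtain ⟨K, hK⟩ := SqrtSampling.exists_bound_realRestrict ha hφ
    obtain ⟨θ, hθ, hfh⟩ := SqrtSampling.exists_phase_of_norm_fourier_eq
      (Lp.stronglyMeasurable f) (Lp.stronglyMeasurable h) (Lp.memLp f) (Lp.memLp h)
      (SqrtSampling.continuous_realRestrict hφ.1.continuous) (SqrtSampling.memLp_realRestrict ha hφ)
      hK (SqrtSampling.dense_fourier_ne_zero ha hb hφ hφ0) (fun x ξ => by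
        have := hall (Sum.elim x.ofLp ξ.ofLp)
        simpa only [SqrtSampling.stftAt, SqrtSampling.stft_eq_fourier, Sum.elim_inl, Sum.elim_inr]
          using this)
    refine ⟨θ, hθ, Lp.ext ?_⟩
    filter_upwards [hfh, Lp.coeFn_smul θ h] with t h1 h2
    rw [h1, h2, Pi.smul_apply, smul_eq_mul]
  · rintro ⟨θ, hθ, rfl⟩ p _
    refine SqrtSampling.norm_stftAt_eq_of_ae_eq_mul hθ ?_ p
    filter_upwards [Lp.coeFn_smul θ h] with t ht
    rw [ht, Pi.smul_apply, smul_eq_mul]
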